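/- All rings are commutative with $1\neq 0$ and ring homomorphisms are unital. A minimal ring homomorphism is an injective, non-surjective ring homomorphism $f:R\hookrightarrow T$ such that, identifying $R$ with $f(R)$, there is no ring $S$ with $R\subsetneq S\subsetneq T$. For a ring extension $A\subseteq B$ let $(A:B)=\{b\in B : bB\subseteq A\}$ be its conductor, an ideal of $A$. For a maximal ideal $J$ of $R$ let $T_J$ be the localization of $T$ at the multiplicative set $R\setminus J$; the ideal $J$ is called crucial for $f$ if the canonical homomorphism $R_J\to T_J$ is not an isomorphism (for a minimal ring homomorphism there is exactly one such $J$). Let $f:R\hookrightarrow T$ be a minimal ring homomorphism that is a flat epimorphism of rings, with crucial maximal ideal $J$. Then $R_J/(R_J:T_J)$ is a local domain of Krull dimension one, and $T_J=R_{(R:T)}$; that is, $(R:T)$ is a prime ideal of $R$ and $T_J$ is isomorphic, as an $R$-algebra, to the localization of $R$ at $(R:T)$. -/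

import Mathlib

/-- The ring homomorphism `R → T` is minimal: it is injective and its image is a maximal proper
subring of `T`, i.e. it is not surjective and no ring lies strictly between `R` and `T`. -/
def IsMinimalRingHom (R T : Type*) [CommRing R] [CommRing T] [Algebra R T] : Prop :=
  Function.Injective (algebraMap R T) ∧ IsCoatom (algebraMap R T).range

/-- The conductor `(A : B)` of a ring extension `A ⊆ B`, as an ideal of `A`. (An element `b` of `B`
with `b B ⊆ A` is automatically in `A`, as `b = b * 1`.) -/
def extensionConductor (A B : Type*) [CommRing A] [CommRing B] [Algebra A B] : Ideal A where
  carrier := {a | ∀ b : B, algebraMap A B a * b ∈ (algebraMap A B).range}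
  zero_mem' b := by simp
  add_mem' hx hy b := by
    rw [map_add, add_mul]
    exact add_mem (hx b) (hy b)
  smul_mem' c x hx b := by
    rw [smul_eq_mul, map_mul, mul_assoc]
    exact mul_mem ⟨c, rfl⟩ (hx b)

/-- `T_J`, the localization of the `R`-algebra `T` at (the image of) the multiplicative set
`R \ J`. It is an algebra over `R_J = Localization.AtPrime J` in the canonical way. -/
abbrev LocalizedAt {R : Type*} (T : Type*) [CommRing R] [CommRing T] [Algebra R T]
    (J : Ideal R) [J.IsPrime] : Type _ :=
  Localization (Algebra.algebraMapSubmonoid T J.primeCompl)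

/-- The maximal ideal `J` of `R` is crucial for `R → T`: the canonical map `R_J → T_J` is not an
isomorphism. -/
def IsCrucialMaximalIdeal {R : Type*} (T : Type*) [CommRing R] [CommRing T] [Algebra R T]
    (J : Ideal R) [J.IsMaximal] : Prop :=
  ¬ Function.Bijective (algebraMap (Localization.AtPrime J) (LocalizedAt T J))

/-! Minimality, flatness and the epimorphism property all pass to `R_J → T_J`, so the core is a
local ring `(A, m)` and a minimal flat epimorphism `A → B`. Faithfully flat epimorphisms are
surjective, hence `mB = B`. For `a` in `A`, minimality makes the subring `A + aB` equal to `A`, so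
that `a` is in the conductor `P`, or to `B`, in which case `mB = B` forces `aB = B`. So `P` consists
of the elements of `A` that are not units of `B`, and is prime. If `s ∈ m` is a unit of `B`,
minimality gives `B = A[1/s]`; hence `B = A_P`, and no prime lies strictly between `P` and `m`.
Since `P` contracts to `(R:T)`, this descends to `R`. -/

open TensorProduct in
/-- A faithfully flat epimorphism of rings is surjective. -/
theorem Algebra.IsEpi.surjective_algebraMap_of_faithfullyFlat (A B : Type*) [CommRing A]
    [CommRing B] [Algebra A B] [Algebra.IsEpi A B] [Module.FaithfullyFlat A B] :
    Function.Surjective (algebraMap A B) := by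
  have h : Function.Surjective ((Algebra.linearMap A B).lTensor B) := by
    intro x
    induction x with
    | zero => exact ⟨0, map_zero _⟩
    | add x y hx hy =>
      obtain ⟨x, rfl⟩ := hx
      obtain ⟨y, rfl⟩ := hy
      exact ⟨x + y, map_add _ _ _⟩
    | tmul b c =>
      -- For an epimorphism, `c ⊗ 1 = 1 ⊗ c`, so every tensor can be moved to the left factor.
      refine ⟨(b * c) ⊗ₜ 1, ?_⟩
      calc (b * c) ⊗ₜ[A] (algebraMap A B 1) = (b ⊗ₜ[A] 1) * (c ⊗ₜ[A] 1) := by simp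
        _ = (b ⊗ₜ[A] 1) * (1 ⊗ₜ[A] c) := by rw [Algebra.tmul_comm A c 1]
        _ = b ⊗ₜ[A] c := by simp
  exact (Module.FaithfullyFlat.lTensor_surjective_iff_surjective A B _).mp h

/-- Over a local ring, the maximal ideal extends to the unit ideal in any flat epimorphism that is
not surjective. -/
theorem IsLocalRing.map_maximalIdeal_eq_top_of_isEpi {A B : Type*} [CommRing A] [CommRing B]
    [Algebra A B] [IsLocalRing A] [Module.Flat A B] [Algebra.IsEpi A B]
    (h : ¬ Function.Surjective (algebraMap A B)) :
    (IsLocalRing.maximalIdeal A).map (algebraMap A B) = ⊤ := by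
  by_contra hne
  have : Module.FaithfullyFlat A B := by
    refine ⟨fun m hm htop ↦ hne ?_⟩
    rw [← IsLocalRing.eq_maximalIdeal hm]
    rw [Ideal.smul_top_eq_map] at htop
    exact (Submodule.restrictScalars_eq_top_iff A B B).mp htop
  exact h (Algebra.IsEpi.surjective_algebraMap_of_faithfullyFlat A B)

namespace IsMinimalRingHom

/-! ### Minimal extensions of a local ring -/

section

variable {A B : Type*} [CommRing A] [CommRing B] [Algebra A B]

theorem not_surjective (h : IsMinimalRingHom A B) : ¬ Function.Surjective (algebraMap A B) :=
  fun hs ↦ h.2.1 (RingHom.range_eq_top.mpr hs)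

theorem eq_range_or_eq_top (h : IsMinimalRingHom A B) (S : Subring B)
    (hS : ∀ a, algebraMap A B a ∈ S) : S = (algebraMap A B).range ∨ S = ⊤ := by
  have hle : (algebraMap A B).range ≤ S := by
    rintro _ ⟨a, rfl⟩
    exact hS a
  exact (hle.eq_or_lt).imp Eq.symm (h.2.2 S)

theorem one_notMem_conductor (h : IsMinimalRingHom A B) : (1 : A) ∉ extensionConductor A B :=
  fun h1 ↦ h.not_surjective fun b ↦ by simpa using h1 b

/-- If the maximal ideal of `A` extends to the unit ideal of `B`, then the elements of `A` outside
the conductor are units of `B`. -/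
theorem isUnit_of_notMem_conductor [IsLocalRing A] (h : IsMinimalRingHom A B)
    (htop : (IsLocalRing.maximalIdeal A).map (algebraMap A B) = ⊤) {a : A}
    (ha : a ∉ extensionConductor A B) : IsUnit (algebraMap A B a) := by
  by_cases hu : IsUnit a
  · exact hu.map _
  let I : Ideal B := Ideal.span {algebraMap A B a}
  -- This is `A + aB`.
  let S : Subring B := ((Ideal.Quotient.mk I).comp (algebraMap A B)).range.comap
    (Ideal.Quotient.mk I)
  have hmem (b : B) : b ∈ S ↔ ∃ x : A, Ideal.Quotient.mk I (algebraMap A B x) =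
      Ideal.Quotient.mk I b := Iff.rfl
  rcases h.eq_range_or_eq_top S fun x ↦ ⟨x, rfl⟩ with hS | hS
  · refine absurd (fun b ↦ ?_) ha
    rw [← hS, hmem]
    refine ⟨0, ?_⟩
    rw [map_zero, map_zero, eq_comm, Ideal.Quotient.eq_zero_iff_mem]
    exact Ideal.mul_mem_right _ _ (Ideal.mem_span_singleton_self _)
  · rw [← Ideal.span_singleton_eq_top]
    by_contra hI
    have : Nontrivial (B ⧸ I) := Ideal.Quotient.nontrivial_iff.mpr hI
    let f : A →+* B ⧸ I := (Ideal.Quotient.mk I).comp (algebraMap A B)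
    have hf : Function.Surjective f := by
      intro y
      obtain ⟨b, rfl⟩ := Ideal.Quotient.mk_surjective y
      exact (hmem b).mp (hS ▸ Subring.mem_top b)
    -- The surjection `f` has kernel inside `m`, so the image of `m` should be proper; but `mB = B`.
    have hker : RingHom.ker f ≤ IsLocalRing.maximalIdeal A :=
      IsLocalRing.le_maximalIdeal (RingHom.ker_ne_top f)
    have hmap : (IsLocalRing.maximalIdeal A).map f = ⊤ := by
      rw [← Ideal.map_map, htop, Ideal.map_top]
    have hcomap := Ideal.comap_map_of_surjective f hf (IsLocalRing.maximalIdeal A)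
    rw [hmap, Ideal.comap_top] at hcomap
    refine (IsLocalRing.maximalIdeal.isMaximal A).ne_top (top_le_iff.mp ?_)
    rw [hcomap]
    exact sup_le le_rfl hker

/-- The elements of the conductor are not units of `B`. -/
theorem not_isUnit_of_mem_conductor (h : IsMinimalRingHom A B) {a : A}
    (ha : a ∈ extensionConductor A B) : ¬ IsUnit (algebraMap A B a) := by
  rintro ⟨u, hu⟩
  refine h.not_surjective fun b ↦ ?_
  obtain ⟨x, hx⟩ := ha (↑u⁻¹ * b)
  exact ⟨x, by rw [hx, ← hu, Units.mul_inv_cancel_left]⟩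

theorem notMem_conductor_iff_isUnit [IsLocalRing A] (h : IsMinimalRingHom A B)
    (htop : (IsLocalRing.maximalIdeal A).map (algebraMap A B) = ⊤) {a : A} :
    a ∉ extensionConductor A B ↔ IsUnit (algebraMap A B a) :=
  ⟨h.isUnit_of_notMem_conductor htop, fun hu ha ↦ h.not_isUnit_of_mem_conductor ha hu⟩

theorem isPrime_conductor [IsLocalRing A] (h : IsMinimalRingHom A B)
    (htop : (IsLocalRing.maximalIdeal A).map (algebraMap A B) = ⊤) :
    (extensionConductor A B).IsPrime := by
  refine ⟨fun hP ↦ h.one_notMem_conductor (hP ▸ Submodule.mem_top), fun {a b} hab ↦ ?_⟩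
  by_contra! hc
  simp only [h.notMem_conductor_iff_isUnit htop] at hc
  exact h.not_isUnit_of_mem_conductor hab (by rw [map_mul]; exact hc.1.mul hc.2)

/-- Every element of `B` is carried into `A` by a power of any non-unit of `A` that is invertible
in `B`. -/
theorem exists_pow_mul_mem_range (h : IsMinimalRingHom A B) {s : A} (hs : ¬ IsUnit s)
    (hsB : IsUnit (algebraMap A B s)) (b : B) :
    ∃ n : ℕ, ∃ a : A, algebraMap A B s ^ n * b = algebraMap A B a := by
  -- This is `A[1/s]`; it contains the inverse of `s`, so it cannot be `A`.
  let S : Subring B :=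
    { carrier := {b | ∃ n : ℕ, ∃ a : A, algebraMap A B s ^ n * b = algebraMap A B a}
      zero_mem' := ⟨0, 0, by simp⟩
      one_mem' := ⟨0, 1, by simp⟩
      neg_mem' := by
        rintro x ⟨n, a, hx⟩
        exact ⟨n, -a, by rw [mul_neg, hx, map_neg]⟩
      add_mem' := by
        rintro x y ⟨n, a, hx⟩ ⟨m, c, hy⟩
        refine ⟨n + m, s ^ m * a + s ^ n * c, ?_⟩
        simp only [map_add, map_mul, map_pow, ← hx, ← hy]
        ring
      mul_mem' := by
        rintro x y ⟨n, a, hx⟩ ⟨m, c, hy⟩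
        refine ⟨n + m, a * c, ?_⟩
        simp only [map_mul, ← hx, ← hy]
        ring }
  rcases h.eq_range_or_eq_top S fun a ↦ ⟨0, a, by simp⟩ with hS | hS
  · obtain ⟨u, hu⟩ := hsB
    have hmem : (↑u⁻¹ : B) ∈ S := ⟨1, 1, by simp [← hu]⟩
    rw [hS] at hmem
    obtain ⟨x, hx⟩ := hmem
    refine absurd (IsUnit.of_mul_eq_one x (h.1 ?_)) hs
    rw [map_mul, hx, ← hu, Units.mul_inv, map_one]
  · have hb : b ∈ S := hS ▸ Subring.mem_top b
    exact hb

/-- The conductor is also an ideal of `B`; if it contained `m`, it would contain `mB = B`. -/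
theorem exists_mem_maximalIdeal_notMem_conductor [IsLocalRing A] (h : IsMinimalRingHom A B)
    (htop : (IsLocalRing.maximalIdeal A).map (algebraMap A B) = ⊤) :
    ∃ s ∈ IsLocalRing.maximalIdeal A, s ∉ extensionConductor A B := by
  by_contra! hle
  let C : Ideal B :=
    { carrier := {b | ∀ c : B, b * c ∈ (algebraMap A B).range}
      zero_mem' := fun c ↦ by simp
      add_mem' := fun hx hy c ↦ by
        rw [add_mul]
        exact add_mem (hx c) (hy c)
      smul_mem' := fun d x hx c ↦ by
        rw [smul_eq_mul, mul_comm d, mul_assoc]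
        exact hx _ }
  have hC : (IsLocalRing.maximalIdeal A).map (algebraMap A B) ≤ C :=
    Ideal.map_le_iff_le_comap.mpr hle
  have h1 : (1 : B) ∈ C := hC (htop ▸ Submodule.mem_top)
  exact h.not_surjective fun b ↦ by simpa using h1 b

/-- `B` is the localization of `A` at the conductor. -/
theorem isLocalization_atPrime_conductor [IsLocalRing A] (h : IsMinimalRingHom A B)
    (htop : (IsLocalRing.maximalIdeal A).map (algebraMap A B) = ⊤)
    [(extensionConductor A B).IsPrime] :
    IsLocalization.AtPrime B (extensionConductor A B) := by
  obtain ⟨s, hsM, hsP⟩ := h.exists_mem_maximalIdeal_notMem_conductor htop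
  refine ⟨fun y ↦ h.isUnit_of_notMem_conductor htop y.2, fun b ↦ ?_, fun {x y} hxy ↦
    ⟨1, by rw [h.1 hxy]⟩⟩
  obtain ⟨n, a, hb⟩ := h.exists_pow_mul_mem_range hsM (h.isUnit_of_notMem_conductor htop hsP) b
  refine ⟨⟨a, ⟨s ^ n, Submonoid.pow_mem _ hsP n⟩⟩, ?_⟩
  simpa [mul_comm] using hb

/-- The conductor and the maximal ideal are the only prime ideals of `A` containing the
conductor. -/
theorem eq_maximalIdeal_of_conductor_lt [IsLocalRing A] (h : IsMinimalRingHom A B)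
    (htop : (IsLocalRing.maximalIdeal A).map (algebraMap A B) = ⊤) {Q : Ideal A} [hQ : Q.IsPrime]
    (hlt : extensionConductor A B < Q) : Q = IsLocalRing.maximalIdeal A := by
  obtain ⟨q, hqQ, hqP⟩ := SetLike.exists_of_lt hlt
  refine le_antisymm (IsLocalRing.le_maximalIdeal hQ.ne_top) fun s hsM ↦ ?_
  by_contra hsQ
  obtain ⟨u, hu⟩ := h.isUnit_of_notMem_conductor htop hqP
  -- Writing `1/q` as `a / s ^ n` shows that `q` divides a power of `s`.
  obtain ⟨n, a, hb⟩ := h.exists_pow_mul_mem_range hsM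
    (h.isUnit_of_notMem_conductor htop fun hs ↦ hsQ (hlt.le hs)) (↑u⁻¹ : B)
  have hsn : s ^ n = a * q := h.1 (by
    rw [map_mul, map_pow, ← hb, ← hu, mul_assoc, Units.inv_mul, mul_one])
  exact hsQ (hQ.mem_of_pow_mem n (hsn ▸ Ideal.mul_mem_left _ _ hqQ))

theorem ringKrullDim_quotient_conductor [IsLocalRing A] (h : IsMinimalRingHom A B)
    (htop : (IsLocalRing.maximalIdeal A).map (algebraMap A B) = ⊤) :
    ringKrullDim (A ⧸ extensionConductor A B) = 1 := by
  have hP := h.isPrime_conductor htop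
  have hne : extensionConductor A B < IsLocalRing.maximalIdeal A := by
    obtain ⟨s, hsM, hsP⟩ := h.exists_mem_maximalIdeal_notMem_conductor htop
    exact lt_of_le_not_ge (IsLocalRing.le_maximalIdeal hP.ne_top) fun hle ↦ hsP (hle hsM)
  apply le_antisymm
  · have : Ring.KrullDimLE 1 (A ⧸ extensionConductor A B) := by
      rw [Ring.krullDimLE_one_iff_of_noZeroDivisors]
      intro I hI hIp
      have hlt : extensionConductor A B < I.comap (Ideal.Quotient.mk _) := by
        refine lt_of_le_of_ne (fun x hx ↦ ?_) fun heq ↦ hI ?_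
        · rw [Ideal.mem_comap, Ideal.Quotient.eq_zero_iff_mem.mpr hx]
          exact I.zero_mem
        · rw [← Ideal.map_comap_of_surjective _ Ideal.Quotient.mk_surjective I, ← heq,
            Ideal.map_quotient_self]
      have hmax : (I.comap (Ideal.Quotient.mk (extensionConductor A B))).IsMaximal := by
        rw [h.eq_maximalIdeal_of_conductor_lt htop hlt]
        infer_instance
      rw [← Ideal.map_comap_of_surjective _ Ideal.Quotient.mk_surjective I]
      exact (Ideal.map_eq_top_or_isMaximal_of_surjective _ Ideal.Quotient.mk_surjective
        hmax).resolve_left fun ht ↦ hIp.ne_top <| by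
          rwa [Ideal.map_comap_of_surjective _ Ideal.Quotient.mk_surjective] at ht
    exact Ring.krullDimLE_iff.mp this
  · by_contra! hlt
    have h0 : Ring.KrullDimLE 0 (A ⧸ extensionConductor A B) := by
      rw [Ring.krullDimLE_iff]
      exact Order.le_of_lt_succ hlt
    have hf : IsField (A ⧸ extensionConductor A B) :=
      Ring.KrullDimLE.isField_of_isDomain
    exact hne.ne ((Ideal.Quotient.maximal_of_isField _ hf).eq_of_le
      (IsLocalRing.maximalIdeal.isMaximal A).ne_top hne.le)

end

/-! ### Localization at the crucial ideal -/

section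

variable {R T : Type*} [CommRing R] [CommRing T] [Algebra R T] (J : Ideal R) [J.IsPrime]

theorem injective_algebraMap_localizedAt (h : Function.Injective (algebraMap R T)) :
    Function.Injective (algebraMap (Localization.AtPrime J) (LocalizedAt T J)) :=
  have : IsLocalization (J.primeCompl.map (algebraMap R T)) (LocalizedAt T J) :=
    inferInstanceAs (IsLocalization (Algebra.algebraMapSubmonoid T J.primeCompl) _)
  IsLocalization.map_injective_of_injective J.primeCompl _ _ h

/-- Elements of `T_J` are fractions with denominators in `R \ J`. -/
theorem exists_smul_eq_algebraMap_localizedAt (x : LocalizedAt T J) :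
    ∃ u ∈ J.primeCompl, ∃ t : T, u • x = algebraMap T (LocalizedAt T J) t := by
  obtain ⟨⟨t, ⟨_, u, hu, rfl⟩⟩, hx⟩ := IsLocalization.surj
    (Algebra.algebraMapSubmonoid T J.primeCompl) x
  refine ⟨u, hu, t, ?_⟩
  rw [← hx, mul_comm, Algebra.smul_def, ← IsScalarTower.algebraMap_apply]

theorem mem_range_of_smul_mem_range {u : R} (hu : u ∈ J.primeCompl) {x : LocalizedAt T J}
    (hx : u • x ∈ (algebraMap (Localization.AtPrime J) (LocalizedAt T J)).range) :
    x ∈ (algebraMap (Localization.AtPrime J) (LocalizedAt T J)).range := by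
  obtain ⟨a, ha⟩ := hx
  obtain ⟨v, hv⟩ := IsLocalization.map_units (Localization.AtPrime J) (⟨u, hu⟩ : J.primeCompl)
  refine ⟨↑v⁻¹ * a, ?_⟩
  rw [map_mul, ha, Algebra.smul_def,
    IsScalarTower.algebraMap_apply R (Localization.AtPrime J) (LocalizedAt T J), ← mul_assoc,
    ← map_mul]
  change algebraMap _ _ (↑v⁻¹ * algebraMap R (Localization.AtPrime J) (⟨u, hu⟩ : J.primeCompl)) * x
    = x
  rw [← hv, Units.inv_mul, map_one, one_mul]

variable {J}

/-- If `J` is crucial, an element of `T` whose image in `T_J` lies in `R_J` lies in `R`. -/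
theorem mem_range_of_algebraMap_mem_range (h : IsMinimalRingHom R T)
    (hJ : ¬ Function.Bijective (algebraMap (Localization.AtPrime J) (LocalizedAt T J))) {t : T}
    (ht : algebraMap T (LocalizedAt T J) t ∈
      (algebraMap (Localization.AtPrime J) (LocalizedAt T J)).range) :
    t ∈ (algebraMap R T).range := by
  -- If this preimage of `R_J` were all of `T`, clearing denominators would give `T_J = R_J`.
  let S : Subring T := (algebraMap (Localization.AtPrime J) (LocalizedAt T J)).range.comap
    (algebraMap T (LocalizedAt T J))
  rcases h.eq_range_or_eq_top S fun r ↦ ⟨algebraMap R _ r, by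
    rw [← IsScalarTower.algebraMap_apply, ← IsScalarTower.algebraMap_apply]⟩ with hS | hS
  · exact hS ▸ ht
  · refine absurd ⟨injective_algebraMap_localizedAt J h.1, fun x ↦ ?_⟩ hJ
    obtain ⟨u, hu, t, hx⟩ := exists_smul_eq_algebraMap_localizedAt J x
    have hmem : t ∈ S := hS ▸ Subring.mem_top t
    exact mem_range_of_smul_mem_range J hu (hx ▸ hmem)

/-- Minimality passes to the localization at a crucial ideal. -/
theorem localizedAt (h : IsMinimalRingHom R T)
    (hJ : ¬ Function.Bijective (algebraMap (Localization.AtPrime J) (LocalizedAt T J))) :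
    IsMinimalRingHom (Localization.AtPrime J) (LocalizedAt T J) := by
  have hinj := injective_algebraMap_localizedAt (T := T) J h.1
  refine ⟨hinj, fun htop ↦ hJ ⟨hinj, RingHom.range_eq_top.mp htop⟩, fun S hS ↦ ?_⟩
  have hRS (a : Localization.AtPrime J) : algebraMap _ (LocalizedAt T J) a ∈ S := hS.le ⟨a, rfl⟩
  rcases h.eq_range_or_eq_top (S.comap (algebraMap T (LocalizedAt T J))) fun r ↦ by
    rw [Subring.mem_comap, ← IsScalarTower.algebraMap_apply,
      IsScalarTower.algebraMap_apply R (Localization.AtPrime J)]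
    exact hRS _ with hS' | hS'
  · refine absurd (fun x hx ↦ ?_) hS.not_ge
    obtain ⟨u, hu, t, hxt⟩ := exists_smul_eq_algebraMap_localizedAt J x
    have ht : t ∈ S.comap (algebraMap T (LocalizedAt T J)) := by
      rw [Subring.mem_comap, ← hxt, Algebra.smul_def,
        IsScalarTower.algebraMap_apply R (Localization.AtPrime J)]
      exact mul_mem (hRS _) hx
    rw [hS'] at ht
    obtain ⟨r, rfl⟩ := ht
    refine mem_range_of_smul_mem_range J hu ⟨algebraMap R _ r, ?_⟩
    rw [hxt, ← IsScalarTower.algebraMap_apply, ← IsScalarTower.algebraMap_apply]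
  · refine eq_top_iff.mpr fun x _ ↦ ?_
    obtain ⟨u, hu, t, hxt⟩ := exists_smul_eq_algebraMap_localizedAt J x
    have ht : t ∈ S.comap (algebraMap T (LocalizedAt T J)) := hS' ▸ Subring.mem_top t
    obtain ⟨v, hv⟩ := IsLocalization.map_units (Localization.AtPrime J) (⟨u, hu⟩ : J.primeCompl)
    have hxS : x = algebraMap _ (LocalizedAt T J) (↑v⁻¹ : Localization.AtPrime J) *
        algebraMap T _ t := by
      rw [← hxt, Algebra.smul_def, IsScalarTower.algebraMap_apply R (Localization.AtPrime J),
        ← mul_assoc, ← map_mul]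
      change x = algebraMap _ _
        (↑v⁻¹ * algebraMap R (Localization.AtPrime J) (⟨u, hu⟩ : J.primeCompl)) * x
      rw [← hv, Units.inv_mul, map_one, one_mul]
    rw [hxS]
    exact mul_mem (hRS _) ht

/-- The conductor of `R ⊆ T` is the contraction of the conductor of `R_J ⊆ T_J` when `J` is
crucial. -/
theorem comap_conductor_localizedAt (h : IsMinimalRingHom R T)
    (hJ : ¬ Function.Bijective (algebraMap (Localization.AtPrime J) (LocalizedAt T J))) :
    (extensionConductor (Localization.AtPrime J) (LocalizedAt T J)).comap
      (algebraMap R (Localization.AtPrime J)) = extensionConductor R T := by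
  ext r
  constructor
  · intro hr t
    refine h.mem_range_of_algebraMap_mem_range hJ ?_
    rw [map_mul, ← IsScalarTower.algebraMap_apply,
      IsScalarTower.algebraMap_apply R (Localization.AtPrime J)]
    exact hr _
  · intro hr x
    obtain ⟨u, hu, t, hxt⟩ := exists_smul_eq_algebraMap_localizedAt J x
    obtain ⟨y, hy⟩ := hr t
    refine mem_range_of_smul_mem_range J hu ⟨algebraMap R _ y, ?_⟩
    rw [← mul_smul_comm, hxt, ← IsScalarTower.algebraMap_apply, ← IsScalarTower.algebraMap_apply,
      IsScalarTower.algebraMap_apply R T, IsScalarTower.algebraMap_apply R T (LocalizedAt T J) r,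
      ← map_mul, hy]

end

end IsMinimalRingHom

/-! ### Flat epimorphisms under localization, and the conclusion -/

open TensorProduct in
theorem isEpi_localizedAt {R T : Type*} [CommRing R] [CommRing T] [Algebra R T]
    [Algebra.IsEpi R T] (J : Ideal R) [J.IsPrime] :
    Algebra.IsEpi (Localization.AtPrime J) (LocalizedAt T J) := by
  rw [Algebra.isEpi_iff_forall_one_tmul_eq]
  intro x
  obtain ⟨u, hu, t, hxt⟩ := IsMinimalRingHom.exists_smul_eq_algebraMap_localizedAt J x
  obtain ⟨v, hv⟩ := IsLocalization.map_units (Localization.AtPrime J) (⟨u, hu⟩ : J.primeCompl)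
  have hx : x = (↑v⁻¹ : Localization.AtPrime J) • algebraMap T (LocalizedAt T J) t := by
    rw [← hxt, ← algebraMap_smul (Localization.AtPrime J) u x, smul_smul]
    change x = (↑v⁻¹ * algebraMap R (Localization.AtPrime J) (⟨u, hu⟩ : J.primeCompl)) • x
    rw [← hv, Units.inv_mul, one_smul]
  -- This map carries `1 ⊗ t = t ⊗ 1` over to `T_J`; the denominators are scalars of `R_J`.
  let f : T ⊗[R] T →ₐ[R] LocalizedAt T J ⊗[Localization.AtPrime J] LocalizedAt T J :=
    Algebra.TensorProduct.lift
      (((Algebra.TensorProduct.includeLeft : LocalizedAt T J →ₐ[Localization.AtPrime J]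
        LocalizedAt T J ⊗[Localization.AtPrime J] LocalizedAt T J).restrictScalars R).comp
        (IsScalarTower.toAlgHom R T (LocalizedAt T J)))
      (((Algebra.TensorProduct.includeRight : LocalizedAt T J →ₐ[Localization.AtPrime J]
        LocalizedAt T J ⊗[Localization.AtPrime J] LocalizedAt T J).restrictScalars R).comp
        (IsScalarTower.toAlgHom R T (LocalizedAt T J))) fun _ _ ↦ Commute.all _ _
  have ht : (1 : LocalizedAt T J) ⊗ₜ[Localization.AtPrime J] algebraMap T (LocalizedAt T J) t =
      algebraMap T (LocalizedAt T J) t ⊗ₜ 1 := by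
    have := congrArg f (Algebra.tmul_comm R (1 : T) t)
    simpa [f] using this
  rw [hx, TensorProduct.tmul_smul, ht, TensorProduct.smul_tmul']

theorem flat_localizedAt {R T : Type*} [CommRing R] [CommRing T] [Algebra R T]
    [Module.Flat R T] (J : Ideal R) [J.IsPrime] :
    Module.Flat (Localization.AtPrime J) (LocalizedAt T J) :=
  (Module.flat_iff_of_isLocalization _ J.primeCompl _).mpr inferInstance

theorem proposition3p5 {R T : Type*} [CommRing R] [CommRing T] [Algebra R T]
    (hmin : IsMinimalRingHom R T) (hflat : Module.Flat R T) (hepi : Algebra.IsEpi R T)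
    (J : Ideal R) [J.IsMaximal] (hJ : IsCrucialMaximalIdeal T J) :
    (IsDomain (Localization.AtPrime J ⧸
        extensionConductor (Localization.AtPrime J) (LocalizedAt T J)) ∧
      IsLocalRing (Localization.AtPrime J ⧸
        extensionConductor (Localization.AtPrime J) (LocalizedAt T J)) ∧
      ringKrullDim (Localization.AtPrime J ⧸
        extensionConductor (Localization.AtPrime J) (LocalizedAt T J)) = 1) ∧
    ∃ _ : (extensionConductor R T).IsPrime,
      Nonempty (LocalizedAt T J ≃ₐ[R] Localization.AtPrime (extensionConductor R T)) := by
  have h := hmin.localizedAt hJ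
  have := isEpi_localizedAt (T := T) J
  have := flat_localizedAt (T := T) J
  have htop := IsLocalRing.map_maximalIdeal_eq_top_of_isEpi h.not_surjective
  have hP := h.isPrime_conductor htop
  refine ⟨⟨inferInstance, .of_surjective' _ Ideal.Quotient.mk_surjective,
    h.ringKrullDim_quotient_conductor htop⟩, ?_⟩
  have hB := h.isLocalization_atPrime_conductor htop
  -- Localizing `R_J` at a prime is localizing `R` at its contraction, here `(R:T)`.
  have hloc := IsLocalization.isLocalization_isLocalization_atPrime_isLocalization J.primeCompl
    (LocalizedAt T J) (extensionConductor (Localization.AtPrime J) (LocalizedAt T J))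
  have hcomap := hmin.comap_conductor_localizedAt hJ
  have hprime : (extensionConductor R T).IsPrime := hcomap ▸ inferInstance
  have hRT : IsLocalization.AtPrime (LocalizedAt T J) (extensionConductor R T) := by
    convert hloc
    exact hcomap.symm
  exact ⟨hprime, ⟨IsLocalization.algEquiv (extensionConductor R T).primeCompl _ _⟩⟩
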